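/- Let $M(u)=\sqrt{2u}\,e^{-2u}\sum_{k=0}^\infty\bigl(\frac{u^k}{k!}\bigr)^2$ for $u\ge 0$. The function $M(\cdot)$ attains a maximum $M=\max_{u\ge 0}M(u)$ on $[0,\infty)$, and $M\approx 0.46882235549939533$, with an error of less than $3\cdot 10^{-14}$. Let $n\ge 0$, let $p_1,\dots,p_n\in[0,1]$, and let $X_1,\dots,X_n$ be independent random variables with $P(X_j=1)=p_j$ and $P(X_j=0)=1-p_j$. Put $S^n=X_1+\cdots+X_n$. Then the standard deviation of $S^n$ is $\sigma^n=\sqrt{\sum_{j=1}^n p_j(1-p_j)}$, and for every integer $i$ $$\sigma^n\,P(S^n=i)\le M .$$ The bound is sharp: if a real number $C$ satisfies $\sigma^n P(S^n=i)\le C$ for all $n$, all $p_1,\dots,p_n\in[0,1]$, all such $S^n$ and all integers $i$, then $M\le C$. More precisely, let $u\ge 0$ be any point at which $M(u)=M$, and for integers $a\ge u$, $a\geq 1$, put $\lambda=u/a$ and let $U$ and $V$ be independent binomial variables, $U\sim B(a,\lambda)$ and $V\sim B(a,1-\lambda)$, so that $U+V$ is distributed as a sum of $2a$ independent Bernoulli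 variables with standard deviation $\sqrt{2a\lambda(1-\lambda)}$. Then $$\sqrt{2a\lambda(1-\lambda)}\;P(U+V=a)\longrightarrow M\qquad (a\to\infty).$$ -/

import Mathlib

open MeasureTheory ProbabilityTheory Filter Topology
open scoped unitInterval

/-- The series `∑ (u^k / k!)^2` converges for every real `u`, so that the `∑'` below is a
genuine sum. -/
theorem summable_sq_pow_div_factorial (u : ℝ) :
    Summable fun k : ℕ => (u ^ k / (k.factorial : ℝ)) ^ 2 := by
  refine Summable.of_nonneg_of_le (fun k => sq_nonneg _) (fun k => ?_)
    (Real.summable_pow_div_factorial (u ^ 2))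
  have h1 : (1 : ℝ) ≤ (k.factorial : ℝ) := by exact_mod_cast k.factorial_pos
  rw [div_pow, ← pow_mul, ← pow_mul, mul_comm k 2]
  exact div_le_div_of_nonneg_left (by rw [pow_mul]; positivity) (by linarith) (by nlinarith)

/-- The function `u ↦ √(2u) e^{-2u} ∑_{k ≥ 0} (u^k / k!)^2`. -/
noncomputable def boundFun (u : ℝ) : ℝ :=
  √(2 * u) * Real.exp (-2 * u) * ∑' k : ℕ, (u ^ k / (k.factorial : ℝ)) ^ 2

/-- The constant `M`, the maximum of `boundFun` over `u ≥ 0` (the theorem asserts that the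
maximum is attained). -/
noncomputable def boundConst : ℝ :=
  sSup (boundFun '' Set.Ici 0)

/-!
Write `G u = ∑ (u^k / k!)^2 = I₀(2u)`, so that `boundFun u = √(2u) e^{-2u} G u`.

*The bound.* The characteristic function `φ` of a Bernoulli variable with parameter `p` satisfies
`|φ t|^2 = 1 - 2p(1-p)(1 - cos t) ≤ exp (-2p(1-p)(1 - cos t))`. Hence a sum of independent Bernoulli
variables with variance `s` has `|φ t| ≤ exp (-s (1 - cos t))`, and Fourier inversion gives
`P(S = i) ≤ (2π)⁻¹ ∫ exp (-s (1 - cos t)) dt = e^{-s} I₀(s)`, that is, `√s P(S = i) ≤ boundFun (s / 2)`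
(`sqrt_mul_measureReal_sum_eq_le`; the integral formula is `boundFun_eq_integral`).

*The maximum.* Bessel's equation for `G` makes `e^{4u} boundFun' u` strictly decreasing
(`hasDerivAt_exp_mul_boundNum_div_sqrt`). So `boundFun'` changes sign at most once, any critical
point is the global maximum, and the maximum exceeds `boundFun a` by at most a multiple of
`boundFun' a` when `a` lies to the left of the critical point (`exists_isMaxOn_boundFun`). Rational
bounds for `boundFun` and its derivative at one point then yield the numerical value.

*Sharpness.* For `U ∼ B(a, l)` and `V ∼ B(a, 1 - l)` the characteristic function of `U + V - a` is
`(1 - 2l(1-l)(1 - cos t))^a`, so that `P(U + V = a)` is its mean over a period. With `l = u / a` the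
integrand tends to `exp (-2u (1 - cos t))` and dominated convergence gives the limit `boundFun u`
(`tendsto_sqrt_mul_integral_pow`).
-/

/-! ### The Bessel series and its differential equation -/

theorem summable_mul_sq_pow_div_factorial {c : ℕ → ℝ} {C : ℝ} (hc : ∀ k, |c k| ≤ C * 4 ^ k)
    (u : ℝ) : Summable fun k : ℕ => c k * (u ^ k / (k.factorial : ℝ)) ^ 2 := by
  refine Summable.of_norm_bounded ((summable_sq_pow_div_factorial (2 * u)).mul_left C) fun k => ?_
  rw [norm_mul, Real.norm_eq_abs, Real.norm_of_nonneg (sq_nonneg _)]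
  calc |c k| * (u ^ k / (k.factorial : ℝ)) ^ 2
      ≤ C * 4 ^ k * (u ^ k / (k.factorial : ℝ)) ^ 2 := by gcongr; exact hc k
    _ = C * ((2 * u) ^ k / (k.factorial : ℝ)) ^ 2 := by
      rw [mul_pow, show (4 : ℝ) ^ k = (2 ^ k) ^ 2 by rw [← pow_mul, mul_comm k, pow_mul]; norm_num]
      ring

/-- Termwise differentiation of `∑ c_k (u^k / k!)^2`, for coefficients of at most exponential
growth. -/
theorem hasDerivAt_tsum_mul_sq_pow_div_factorial {c : ℕ → ℝ} {C : ℝ}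
    (hc : ∀ k, |c k| ≤ C * 2 ^ k) {u : ℝ} (hu : 0 < u) :
    HasDerivAt (fun x : ℝ => ∑' k : ℕ, c k * (x ^ k / (k.factorial : ℝ)) ^ 2)
      ((∑' k : ℕ, (2 * k * c k) * (u ^ k / (k.factorial : ℝ)) ^ 2) / u) u := by
  have hC : 0 ≤ C := by simpa using (abs_nonneg _).trans (hc 0)
  have hck : ∀ k, |2 * k * c k| ≤ 2 * C * 4 ^ k := fun k => by
    have hk : (k : ℝ) ≤ 2 ^ k := by exact_mod_cast k.lt_two_pow_self.le
    rw [abs_mul, abs_of_nonneg (by positivity : (0 : ℝ) ≤ 2 * k)]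
    calc 2 * (k : ℝ) * |c k| ≤ 2 * 2 ^ k * (C * 2 ^ k) := by gcongr; exact hc k
      _ = 2 * C * (2 * 2) ^ k := by rw [mul_pow]; ring
      _ = 2 * C * 4 ^ k := by norm_num
  have hc4 : ∀ k, |c k| ≤ C * 4 ^ k := fun k => (hc k).trans (by gcongr; norm_num)
  rw [← tsum_div_const]
  -- On `(u/2, 2u)` the derivatives `2k c_k (y^k / k!)^2 / y` are dominated by their numerators at
  -- `2u` divided by `u/2`.
  refine hasDerivAt_tsum_of_isPreconnected (t := Set.Ioo (u / 2) (2 * u)) (y₀ := u)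
    (u := fun k => |2 * k * c k| * ((2 * u) ^ k / (k.factorial : ℝ)) ^ 2 / (u / 2))
    ?_ isOpen_Ioo isPreconnected_Ioo (fun k y hy => ?_) (fun k y hy => ?_)
    ⟨by linarith, by linarith⟩ (summable_mul_sq_pow_div_factorial hc4 u) ⟨by linarith, by linarith⟩
    (g' := fun k y => (2 * k * c k) * (y ^ k / (k.factorial : ℝ)) ^ 2 / y)
  · exact (summable_mul_sq_pow_div_factorial (C := 2 * C) (fun k => by rw [abs_abs]; exact hck k)
      _).div_const _
  · have hy0 : y ≠ 0 := by have := hy.1; intro h; linarith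
    refine ((((hasDerivAt_pow k y).div_const (k.factorial : ℝ)).pow 2).const_mul (c k)).congr_deriv ?_
    rcases k with _ | k
    · simp
    · have := k.succ.factorial_pos.ne'
      simp only [Nat.add_sub_cancel]
      push_cast
      field_simp
      ring
  · have h1 : 0 < u / 2 := by positivity
    have h2 : 0 < y := h1.trans hy.1
    rw [norm_div, norm_mul, Real.norm_eq_abs, Real.norm_of_nonneg (sq_nonneg _),
      Real.norm_of_nonneg h2.le]
    gcongr
    · exact hy.2.le
    · exact hy.1.le

/-- The series `∑ (u^k / k!)^2`, that is, the modified Bessel function value `I₀(2u)`. -/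
noncomputable def besselSeries (u : ℝ) : ℝ := ∑' k : ℕ, (u ^ k / (k.factorial : ℝ)) ^ 2

/-- The series `∑ 2k (u^k / k!)^2`, that is, `u` times the derivative of `besselSeries` at `u`. -/
noncomputable def eulerBesselSeries (u : ℝ) : ℝ :=
  ∑' k : ℕ, (2 * k) * (u ^ k / (k.factorial : ℝ)) ^ 2

theorem abs_two_mul_natCast_le (k : ℕ) : |(2 * k : ℝ)| ≤ 2 * 2 ^ k := by
  have hk : (k : ℝ) ≤ 2 ^ k := by exact_mod_cast k.lt_two_pow_self.le
  rw [abs_of_nonneg (by positivity)]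
  linarith

theorem besselSeries_pos (u : ℝ) : 0 < besselSeries u :=
  (summable_sq_pow_div_factorial u).tsum_pos (fun _ => sq_nonneg _) 0 (by simp)

theorem hasDerivAt_besselSeries {u : ℝ} (hu : 0 < u) :
    HasDerivAt besselSeries (eulerBesselSeries u / u) u := by
  change HasDerivAt (fun x : ℝ => ∑' k : ℕ, (x ^ k / (k.factorial : ℝ)) ^ 2) _ u
  simpa [eulerBesselSeries] using
    hasDerivAt_tsum_mul_sq_pow_div_factorial (c := fun _ => 1) (C := 1)
      (fun k => by simpa using one_le_pow₀ (by norm_num : (1 : ℝ) ≤ 2)) hu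

/-- Bessel's equation `(u I')' = 4 u I` for `I u = I₀(2u)`. -/
theorem hasDerivAt_eulerBesselSeries {u : ℝ} (hu : 0 < u) :
    HasDerivAt eulerBesselSeries (4 * u * besselSeries u) u := by
  refine (hasDerivAt_tsum_mul_sq_pow_div_factorial (c := fun k => 2 * k) (C := 2)
    abs_two_mul_natCast_le hu).congr_deriv ?_
  have hs : Summable fun k : ℕ => (2 * k * (2 * k) : ℝ) * (u ^ k / (k.factorial : ℝ)) ^ 2 := by
    refine summable_mul_sq_pow_div_factorial (C := 4) (fun k => ?_) u
    have hk : (k : ℝ) ≤ 2 ^ k := by exact_mod_cast k.lt_two_pow_self.le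
    rw [abs_of_nonneg (by positivity)]
    calc (2 * k * (2 * k) : ℝ) ≤ 2 * 2 ^ k * (2 * 2 ^ k) := by gcongr
      _ = 4 * (2 * 2) ^ k := by rw [mul_pow]; ring
      _ = 4 * 4 ^ k := by norm_num
  rw [hs.tsum_eq_zero_add, besselSeries, div_eq_iff hu.ne', ← tsum_mul_left, ← tsum_mul_right]
  simp only [Nat.cast_zero, mul_zero, zero_mul, zero_add]
  refine tsum_congr fun k => ?_
  rw [Nat.factorial_succ]
  have := k.factorial_pos.ne'
  push_cast
  field_simp
  ring

/-! ### Monotonicity and the maximum of the bound function -/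

/-- The factor that determines the sign of the derivative of `boundFun`:
`boundFun' u = e^{-2u} boundNum u / √(2u)`. -/
noncomputable def boundNum (u : ℝ) : ℝ :=
  besselSeries u - 4 * u * besselSeries u + 2 * eulerBesselSeries u

theorem hasDerivAt_boundFun {u : ℝ} (hu : 0 < u) :
    HasDerivAt boundFun (Real.exp (-2 * u) * boundNum u / √(2 * u)) u := by
  have h2 : 0 < 2 * u := by positivity
  have hR : 0 < √(2 * u) := Real.sqrt_pos.2 h2
  have hRR : √(2 * u) ^ 2 = 2 * u := Real.sq_sqrt h2.le
  refine (((((hasDerivAt_id u).const_mul 2).sqrt h2.ne').mul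
    (((hasDerivAt_id u).const_mul (-2)).exp)).mul (hasDerivAt_besselSeries hu)).congr_deriv ?_
  simp only [boundNum, id, Pi.mul_apply]
  field_simp
  rw [hRR]
  ring

/-- The derivative of `boundFun` multiplied by the integrating factor `e^{4u}` is strictly
decreasing: its derivative is `-e^{2u} I₀(2u) / (2u)^{3/2}`. -/
theorem hasDerivAt_exp_mul_boundNum_div_sqrt {u : ℝ} (hu : 0 < u) :
    HasDerivAt (fun u => Real.exp (2 * u) * boundNum u / √(2 * u))
      (-(Real.exp (2 * u) * besselSeries u / √(2 * u) ^ 3)) u := by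
  have h2 : 0 < 2 * u := by positivity
  have hR : 0 < √(2 * u) := Real.sqrt_pos.2 h2
  have hRR : √(2 * u) ^ 2 = 2 * u := Real.sq_sqrt h2.le
  have hG := hasDerivAt_besselSeries hu
  have hN := (hG.sub (((hasDerivAt_id u).const_mul 4).mul hG)).add
    ((hasDerivAt_eulerBesselSeries hu).const_mul 2)
  refine (((((hasDerivAt_id u).const_mul 2).exp).mul hN).div
    (((hasDerivAt_id u).const_mul 2).sqrt h2.ne') hR.ne').congr_deriv ?_
  simp only [id, Pi.mul_apply, Pi.add_apply, Pi.sub_apply]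
  field_simp
  rw [hRR]
  ring

theorem strictAntiOn_exp_mul_boundNum_div_sqrt :
    StrictAntiOn (fun u => Real.exp (2 * u) * boundNum u / √(2 * u)) (Set.Ioi 0) := by
  refine strictAntiOn_of_deriv_neg (convex_Ioi 0)
    (fun u hu => (hasDerivAt_exp_mul_boundNum_div_sqrt hu).continuousAt.continuousWithinAt)
    fun u hu => ?_
  rw [interior_Ioi] at hu
  rw [(hasDerivAt_exp_mul_boundNum_div_sqrt hu).deriv, neg_lt_zero]
  have : 0 < √(2 * u) := Real.sqrt_pos.2 (mul_pos two_pos hu)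
  have := besselSeries_pos u
  positivity

theorem continuousAt_boundNum {u : ℝ} (hu : 0 < u) : ContinuousAt boundNum u := by
  have h1 := (hasDerivAt_besselSeries hu).continuousAt
  have h2 := (hasDerivAt_eulerBesselSeries hu).continuousAt
  unfold boundNum
  fun_prop

/-- `boundNum` changes sign at most once on `(0, ∞)`, from positive to negative. -/
theorem boundNum_sign_of_le {v w : ℝ} (hv : 0 < v) (hvw : v ≤ w) :
    (0 ≤ boundNum w → 0 ≤ boundNum v) ∧ (boundNum v ≤ 0 → boundNum w ≤ 0) := by
  have hw := hv.trans_le hvw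
  have h := strictAntiOn_exp_mul_boundNum_div_sqrt.antitoneOn hv hw hvw
  have h1 : 0 < √(2 * v) := Real.sqrt_pos.2 (mul_pos two_pos hv)
  have h2 : 0 < √(2 * w) := Real.sqrt_pos.2 (mul_pos two_pos hw)
  constructor
  · intro h0
    have : 0 ≤ Real.exp (2 * v) * boundNum v / √(2 * v) := le_trans (by positivity) h
    by_contra! hneg
    have : Real.exp (2 * v) * boundNum v / √(2 * v) < 0 :=
      div_neg_of_neg_of_pos (mul_neg_of_pos_of_neg (Real.exp_pos _) hneg) h1
    linarith
  · intro h0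
    by_contra! hpos
    have : 0 < Real.exp (2 * w) * boundNum w / √(2 * w) := by positivity
    have : Real.exp (2 * v) * boundNum v / √(2 * v) ≤ 0 :=
      div_nonpos_of_nonpos_of_nonneg
        (mul_nonpos_of_nonneg_of_nonpos (Real.exp_pos _).le h0) h1.le
    linarith

/-- A zero of `boundNum` is a global maximum point of `boundFun`. -/
theorem boundFun_le_of_boundNum_eq_zero {x : ℝ} (hx : 0 < x) (h0 : boundNum x = 0) {u : ℝ}
    (hu : 0 ≤ u) : boundFun u ≤ boundFun x := by
  -- `boundFun` is not differentiable at `0`, where it vanishes.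
  rcases hu.eq_or_lt with rfl | hu
  · have h := besselSeries_pos x
    simp only [boundFun, mul_zero, Real.sqrt_zero, zero_mul]
    change 0 ≤ √(2 * x) * Real.exp (-2 * x) * besselSeries x
    positivity
  rcases le_total u x with hux | hxu
  · refine monotoneOn_of_deriv_nonneg (convex_Icc u x)
      (fun y hy => (hasDerivAt_boundFun (hu.trans_le hy.1)).continuousAt.continuousWithinAt)
      (fun y hy => ?_) (fun y hy => ?_) (Set.left_mem_Icc.2 hux) (Set.right_mem_Icc.2 hux) hux
    all_goals
      rw [interior_Icc] at hy
      have hy0 := hu.trans hy.1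
    · exact (hasDerivAt_boundFun hy0).differentiableAt.differentiableWithinAt
    · rw [(hasDerivAt_boundFun hy0).deriv]
      have := (boundNum_sign_of_le hy0 hy.2.le).1 h0.ge
      positivity
  · refine antitoneOn_of_deriv_nonpos (convex_Icc x u)
      (fun y hy => (hasDerivAt_boundFun (hx.trans_le hy.1)).continuousAt.continuousWithinAt)
      (fun y hy => ?_) (fun y hy => ?_) (Set.left_mem_Icc.2 hxu) (Set.right_mem_Icc.2 hxu) hxu
    all_goals
      rw [interior_Icc] at hy
      have hy0 := hx.trans hy.1
    · exact (hasDerivAt_boundFun hy0).differentiableAt.differentiableWithinAt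
    · rw [(hasDerivAt_boundFun hy0).deriv]
      have := (boundNum_sign_of_le hx hy.1.le).2 h0.le
      exact div_nonpos_of_nonpos_of_nonneg
        (mul_nonpos_of_nonneg_of_nonpos (Real.exp_pos _).le this) (Real.sqrt_nonneg _)

/-- If `boundNum` changes sign on `[a, b]`, then `boundFun` attains its maximum over `[0, ∞)`
there, and the maximum exceeds `boundFun a` by at most `(b - a) boundFun' a`. -/
theorem exists_isMaxOn_boundFun {a b : ℝ} (ha : 0 < a) (hab : a ≤ b) (hNa : 0 ≤ boundNum a)
    (hNb : boundNum b ≤ 0) :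
    ∃ x, 0 < x ∧ (∀ u, 0 ≤ u → boundFun u ≤ boundFun x) ∧
      boundFun x ≤ boundFun a + (b - a) * (Real.exp (-2 * a) * boundNum a / √(2 * a)) := by
  obtain ⟨x, hx, hx0⟩ := intermediate_value_Icc' hab
    (fun u hu => (continuousAt_boundNum (ha.trans_le hu.1)).continuousWithinAt) ⟨hNb, hNa⟩
  have hxpos : 0 < x := ha.trans_le hx.1
  refine ⟨x, hxpos, fun u hu => boundFun_le_of_boundNum_eq_zero hxpos hx0 hu, ?_⟩
  have key : boundFun x - boundFun a ≤
      (Real.exp (-2 * a) * boundNum a / √(2 * a)) * (x - a) := by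
    refine Convex.image_sub_le_mul_sub_of_deriv_le (convex_Icc a x)
      (fun y hy => (hasDerivAt_boundFun (ha.trans_le hy.1)).continuousAt.continuousWithinAt)
      (fun y hy => ?_) (fun y hy => ?_) a (Set.left_mem_Icc.2 hx.1) x (Set.right_mem_Icc.2 hx.1)
      hx.1
    all_goals
      rw [interior_Icc] at hy
      have hy0 := ha.trans hy.1
    · exact (hasDerivAt_boundFun hy0).differentiableAt.differentiableWithinAt
    · rw [(hasDerivAt_boundFun hy0).deriv]
      have hanti : Real.exp (2 * y) * boundNum y / √(2 * y) ≤
        Real.exp (2 * a) * boundNum a / √(2 * a) :=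
        strictAntiOn_exp_mul_boundNum_div_sqrt.antitoneOn ha hy0 hy.1.le
      -- `boundFun'` is the product of two nonincreasing factors, the second nonnegative at `a`.
      have hfac : ∀ z : ℝ, Real.exp (-2 * z) * boundNum z / √(2 * z) =
          Real.exp (-4 * z) * (Real.exp (2 * z) * boundNum z / √(2 * z)) := fun z => by
        rw [show -2 * z = -4 * z + 2 * z by ring, Real.exp_add]; ring
      rw [hfac, hfac a]
      have hmono : Real.exp (-4 * y) ≤ Real.exp (-4 * a) := Real.exp_le_exp.2 (by linarith [hy.1])
      calc _ ≤ Real.exp (-4 * y) * (Real.exp (2 * a) * boundNum a / √(2 * a)) := by gcongr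
        _ ≤ _ := by gcongr
  have hpos : 0 ≤ Real.exp (-2 * a) * boundNum a / √(2 * a) := by positivity
  nlinarith [hx.2]

/-! ### Numerical bounds for the maximum -/

/-- Truncation bounds for `∑ c_k (u^k / k!)^2`: on `[0, 1/2]` the tail is dominated by a geometric
series of ratio `1/2`. -/
theorem tsum_mul_sq_pow_div_factorial_mem_Icc {c : ℕ → ℝ} {C : ℝ} (hc0 : ∀ k, 0 ≤ c k)
    (hc : ∀ k, c k ≤ C * 2 ^ k) {u : ℝ} (hu : 0 ≤ u) (hu' : u ≤ 1 / 2) (n : ℕ) :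
    ∑' k : ℕ, c k * (u ^ k / (k.factorial : ℝ)) ^ 2 ∈
      Set.Icc (∑ k ∈ Finset.range n, c k * (u ^ k / (k.factorial : ℝ)) ^ 2)
        ((∑ k ∈ Finset.range n, c k * (u ^ k / (k.factorial : ℝ)) ^ 2) +
          C * 2 ^ (n + 1) * (u ^ n / (n.factorial : ℝ)) ^ 2) := by
  have hC : 0 ≤ C := by simpa using (hc0 0).trans (hc 0)
  have hs : Summable fun k : ℕ => c k * (u ^ k / (k.factorial : ℝ)) ^ 2 :=
    summable_mul_sq_pow_div_factorial (C := C)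
      (fun k => by rw [abs_of_nonneg (hc0 k)]; exact (hc k).trans (by gcongr; norm_num)) u
  have hnn : ∀ k, 0 ≤ c k * (u ^ k / (k.factorial : ℝ)) ^ 2 :=
    fun k => mul_nonneg (hc0 k) (sq_nonneg _)
  refine ⟨hs.sum_le_tsum _ fun k _ => hnn k, ?_⟩
  rw [← hs.sum_add_tsum_nat_add n]
  gcongr
  have hg := summable_geometric_two.mul_left (C * 2 ^ n * (u ^ n / (n.factorial : ℝ)) ^ 2)
  have hle : ∀ j : ℕ, c (j + n) * (u ^ (j + n) / ((j + n).factorial : ℝ)) ^ 2 ≤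
      C * 2 ^ n * (u ^ n / (n.factorial : ℝ)) ^ 2 * (1 / 2) ^ j := fun j => by
    have hf : (n.factorial : ℝ) ≤ ((j + n).factorial : ℝ) := by
      exact_mod_cast Nat.factorial_le (by lia)
    have hf0 : (0 : ℝ) < n.factorial := by exact_mod_cast n.factorial_pos
    calc c (j + n) * (u ^ (j + n) / ((j + n).factorial : ℝ)) ^ 2
        ≤ (C * 2 ^ (j + n)) * (((1 / 2) ^ j * u ^ n) / (n.factorial : ℝ)) ^ 2 := by
          rw [pow_add u]
          gcongr
          exact hc _
      _ = C * 2 ^ n * (u ^ n / (n.factorial : ℝ)) ^ 2 * (2 * (1 / 2) * (1 / 2)) ^ j := by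
          rw [pow_add, mul_pow, mul_pow]; ring
      _ = _ := by norm_num
  calc _ ≤ ∑' j : ℕ, C * 2 ^ n * (u ^ n / (n.factorial : ℝ)) ^ 2 * (1 / 2) ^ j :=
        ((summable_nat_add_iff n).2 hs).tsum_le_tsum hle hg
    _ = _ := by rw [tsum_mul_left, tsum_geometric_two, pow_succ]; ring

theorem besselSeries_mem_Icc {u : ℝ} (hu : 0 ≤ u) (hu' : u ≤ 1 / 2) (n : ℕ) :
    besselSeries u ∈ Set.Icc (∑ k ∈ Finset.range n, (u ^ k / (k.factorial : ℝ)) ^ 2)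
      ((∑ k ∈ Finset.range n, (u ^ k / (k.factorial : ℝ)) ^ 2) +
        2 ^ (n + 1) * (u ^ n / (n.factorial : ℝ)) ^ 2) := by
  simpa [besselSeries] using
    tsum_mul_sq_pow_div_factorial_mem_Icc (c := fun _ => 1) (C := 1) (fun _ => zero_le_one)
      (fun k => by simpa using one_le_pow₀ (by norm_num : (1 : ℝ) ≤ 2)) hu hu' n

theorem eulerBesselSeries_mem_Icc {u : ℝ} (hu : 0 ≤ u) (hu' : u ≤ 1 / 2) (n : ℕ) :
    eulerBesselSeries u ∈
      Set.Icc (∑ k ∈ Finset.range n, (2 * k : ℝ) * (u ^ k / (k.factorial : ℝ)) ^ 2)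
      ((∑ k ∈ Finset.range n, (2 * k : ℝ) * (u ^ k / (k.factorial : ℝ)) ^ 2) +
        2 * 2 ^ (n + 1) * (u ^ n / (n.factorial : ℝ)) ^ 2) :=
  tsum_mul_sq_pow_div_factorial_mem_Icc (c := fun k => 2 * k) (C := 2) (fun _ => by positivity)
    (fun k => (le_abs_self _).trans (abs_two_mul_natCast_le k)) hu hu' n

/-- A point just below the maximum point `0.394989210671783979078…` of `boundFun`. The maximum is
`0.468822355499424731…`, within `3e-14` of the stated value by a margin of only `6e-16`, so the
bounds below carry about twenty digits. -/
noncomputable def approxArgmax : ℝ := 0.39498921067178397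

theorem besselSeries_approxArgmax :
    besselSeries approxArgmax ∈ Set.Icc 1.162208286281327576581 1.162208286281327576582 := by
  have h := besselSeries_mem_Icc (u := approxArgmax) (by norm_num [approxArgmax])
    (by norm_num [approxArgmax]) 12
  refine ⟨le_trans ?_ h.1, h.2.trans ?_⟩ <;>
    norm_num [Finset.sum_range_succ, Nat.factorial, approxArgmax]

theorem boundNum_approxArgmax : boundNum approxArgmax ∈ Set.Icc 0 (1e-16) := by
  have hG := besselSeries_approxArgmax
  have hL : eulerBesselSeries approxArgmax ∈
      Set.Icc 0.337015324128272845887 0.337015324128272845888 := by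
    have h := eulerBesselSeries_mem_Icc (u := approxArgmax) (by norm_num [approxArgmax])
      (by norm_num [approxArgmax]) 12
    refine ⟨le_trans ?_ h.1, h.2.trans ?_⟩ <;>
      norm_num [Finset.sum_range_succ, Nat.factorial, approxArgmax]
  obtain ⟨hG1, hG2⟩ := hG
  obtain ⟨hL1, hL2⟩ := hL
  rw [boundNum, show besselSeries approxArgmax - 4 * approxArgmax * besselSeries approxArgmax =
    (1 - 4 * 0.39498921067178397) * besselSeries approxArgmax by rw [approxArgmax]; ring]
  constructor <;> norm_num at * <;> linarith

theorem boundNum_half_nonpos : boundNum (1 / 2) ≤ 0 := by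
  have hG := (besselSeries_mem_Icc (u := 1 / 2) (by norm_num) le_rfl 4).1
  have hL := (eulerBesselSeries_mem_Icc (u := 1 / 2) (by norm_num) le_rfl 4).2
  norm_num [Finset.sum_range_succ, Nat.factorial] at hG hL
  norm_num [boundNum]
  linarith

theorem exp_neg_two_mul_approxArgmax :
    Real.exp (-2 * approxArgmax) ∈ Set.Icc 0.453854588748931243905 0.453854588748931243906 := by
  have h := Real.exp_bound (x := -2 * approxArgmax) (n := 21)
    (by norm_num [approxArgmax, abs_of_nonneg]) (by norm_num)
  rw [abs_le] at h
  norm_num [Finset.sum_range_succ, Nat.factorial, approxArgmax, abs_of_nonneg] at h ⊢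
  constructor <;> linarith [h.1, h.2]

theorem sqrt_two_mul_approxArgmax :
    √(2 * approxArgmax) ∈ Set.Icc 0.8888073027060297168336 0.8888073027060297168337 :=
  ⟨Real.le_sqrt_of_sq_le (by norm_num [approxArgmax]),
    Real.sqrt_le_iff.2 ⟨by norm_num, by norm_num [approxArgmax]⟩⟩

theorem boundFun_approxArgmax :
    boundFun approxArgmax ∈ Set.Icc 0.468822355499424731 0.468822355499424732 := by
  change √(2 * approxArgmax) * Real.exp (-2 * approxArgmax) * besselSeries approxArgmax ∈ _
  obtain ⟨hs1, hs2⟩ := sqrt_two_mul_approxArgmax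
  obtain ⟨he1, he2⟩ := exp_neg_two_mul_approxArgmax
  obtain ⟨hG1, hG2⟩ := besselSeries_approxArgmax
  constructor
  · calc (0.468822355499424731 : ℝ)
        ≤ 0.8888073027060297168336 * 0.453854588748931243905 * 1.162208286281327576581 := by
          norm_num
      _ ≤ _ := by gcongr
  · calc _ ≤ 0.8888073027060297168337 * 0.453854588748931243906 * 1.162208286281327576582 := by
          gcongr
      _ ≤ (0.468822355499424732 : ℝ) := by norm_num

theorem exists_boundFun_eq_boundConst :
    ∃ x, 0 < x ∧ boundFun x = boundConst ∧ IsGreatest (boundFun '' Set.Ici 0) boundConst ∧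
      |boundConst - 0.46882235549939533| < 3 * (10 : ℝ)⁻¹ ^ 14 := by
  have ha : 0 < approxArgmax := by norm_num [approxArgmax]
  obtain ⟨hN1, hN2⟩ := boundNum_approxArgmax
  obtain ⟨x, hx, hmax, hle⟩ := exists_isMaxOn_boundFun ha (b := 1 / 2)
    (by norm_num [approxArgmax]) hN1 boundNum_half_nonpos
  have hg : IsGreatest (boundFun '' Set.Ici 0) (boundFun x) :=
    ⟨⟨x, hx.le, rfl⟩, by rintro _ ⟨u, hu, rfl⟩; exact hmax u hu⟩
  have heq : boundFun x = boundConst := hg.csSup_eq.symm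
  refine ⟨x, hx, heq, heq ▸ hg, ?_⟩
  obtain ⟨hB1, hB2⟩ := boundFun_approxArgmax
  have hlow := hmax _ ha.le
  have hslope : Real.exp (-2 * approxArgmax) * boundNum approxArgmax / √(2 * approxArgmax)
      ≤ 1e-16 := by
    obtain ⟨hs1, -⟩ := sqrt_two_mul_approxArgmax
    obtain ⟨-, he2⟩ := exp_neg_two_mul_approxArgmax
    calc _ ≤ 0.453854588748931243906 * 1e-16 / (0.8888073027060297168336 : ℝ) := by gcongr
      _ ≤ 1e-16 := by norm_num
  have hwidth : (1 / 2 - approxArgmax) *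
      (Real.exp (-2 * approxArgmax) * boundNum approxArgmax / √(2 * approxArgmax)) ≤ 1 * 1e-16 := by
    gcongr
    norm_num [approxArgmax]
  rw [← heq, abs_lt]
  norm_num at *
  constructor <;> linarith

/-! ### Integral representation and Fourier inversion -/

theorem integral_cos_pow_two_mul (k : ℕ) :
    ∫ t in (0 : ℝ)..2 * Real.pi, Real.cos t ^ (2 * k) =
      2 * Real.pi * ((2 * k).factorial / (4 ^ k * (k.factorial : ℝ) ^ 2)) := by
  induction k with
  | zero => simp
  | succ k ih =>
    rw [Nat.mul_succ, integral_cos_pow, ih]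
    have := k.factorial_pos.ne'
    simp only [Nat.factorial_succ, Real.sin_two_pi, Real.sin_zero]
    push_cast
    field_simp
    ring

theorem integral_cos_pow_two_mul_add_one (k : ℕ) :
    ∫ t in (0 : ℝ)..2 * Real.pi, Real.cos t ^ (2 * k + 1) = 0 := by
  induction k with
  | zero => simp
  | succ k ih =>
    rw [show 2 * (k + 1) + 1 = 2 * k + 1 + 2 by ring, integral_cos_pow, ih]
    simp

/-- The integral representation `I₀(2u) = (2π)⁻¹ ∫ e^{2u cos t} dt`. -/
theorem integral_exp_mul_cos (u : ℝ) :
    ∫ t in (0 : ℝ)..2 * Real.pi, Real.exp (2 * u * Real.cos t) =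
      2 * Real.pi * besselSeries u := by
  have h : HasSum (fun n : ℕ => ∫ t in (0 : ℝ)..2 * Real.pi,
      (2 * u) ^ n / (n.factorial : ℝ) * Real.cos t ^ n)
      (∫ t in (0 : ℝ)..2 * Real.pi, Real.exp (2 * u * Real.cos t)) := by
    refine intervalIntegral.hasSum_integral_of_dominated_convergence
      (fun n _ => |2 * u| ^ n / (n.factorial : ℝ)) (fun n => ?_) (fun n => ?_) ?_ ?_ ?_
    · exact (by fun_prop : Continuous _).aestronglyMeasurable
    · refine Eventually.of_forall fun t _ => ?_
      rw [norm_mul, norm_div, norm_pow, norm_pow, Real.norm_eq_abs, Real.norm_natCast,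
        Real.norm_eq_abs]
      exact mul_le_of_le_one_right (by positivity)
        (pow_le_one₀ (abs_nonneg _) (Real.abs_cos_le_one t))
    · exact Eventually.of_forall fun t _ => Real.summable_pow_div_factorial _
    · exact intervalIntegrable_const
    · refine Eventually.of_forall fun t _ => ?_
      have := NormedSpace.expSeries_div_hasSum_exp (2 * u * Real.cos t)
      rw [← Real.exp_eq_exp_ℝ] at this
      have hterm : ∀ n : ℕ, (2 * u) ^ n / (n.factorial : ℝ) * Real.cos t ^ n =
          (2 * u * Real.cos t) ^ n / (n.factorial : ℝ) := fun n => by rw [mul_pow _ (Real.cos t)]; ring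
      simpa only [hterm] using this
  have hinj : Function.Injective fun k : ℕ => 2 * k := fun a b hab => by
    simpa using hab
  rw [← hinj.hasSum_iff (fun n hn => ?_)] at h
  · rw [← h.tsum_eq, besselSeries, ← tsum_mul_left]
    refine tsum_congr fun k => ?_
    simp only [Function.comp_apply]
    rw [intervalIntegral.integral_const_mul, integral_cos_pow_two_mul, mul_pow 2 u,
      pow_mul (2 : ℝ)]
    have := k.factorial_pos.ne'
    have := (2 * k).factorial_pos.ne'
    field_simp
    norm_num
    ring
  · rcases Nat.even_or_odd' n with ⟨k, rfl | rfl⟩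
    · exact absurd ⟨k, rfl⟩ hn
    · rw [intervalIntegral.integral_const_mul, integral_cos_pow_two_mul_add_one, mul_zero]

theorem boundFun_eq_integral (u : ℝ) :
    boundFun u = √(2 * u) * ((2 * Real.pi)⁻¹ *
      ∫ t in (0 : ℝ)..2 * Real.pi, Real.exp (-(2 * u * (1 - Real.cos t)))) := by
  have h : ∀ t : ℝ, Real.exp (-(2 * u * (1 - Real.cos t))) =
      Real.exp (-2 * u) * Real.exp (2 * u * Real.cos t) := fun t => by
    rw [← Real.exp_add]; ring_nf
  simp_rw [h]
  rw [intervalIntegral.integral_const_mul, integral_exp_mul_cos, boundFun, besselSeries]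
  have := Real.pi_pos.ne'
  field_simp

theorem integral_exp_int_mul_I (m : ℤ) :
    ∫ t in (0 : ℝ)..2 * Real.pi, Complex.exp (m * Complex.I * t) =
      if m = 0 then (2 * Real.pi : ℂ) else 0 := by
  split_ifs with h
  · simp [h]
  · have hm : (m * Complex.I : ℂ) ≠ 0 := mul_ne_zero (by exact_mod_cast h) Complex.I_ne_zero
    rw [integral_exp_mul_complex hm]
    have : Complex.exp (m * Complex.I * ((2 * Real.pi : ℝ) : ℂ)) = 1 := by
      rw [Complex.exp_eq_one_iff]
      exact ⟨m, by push_cast; ring⟩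
    rw [this]
    simp

/-- Fourier inversion for a law carried by the integers: the mass at `i` is a Fourier coefficient
of the characteristic function. -/
theorem measureReal_singleton_eq_integral_charFun (ν : Measure ℝ) [IsProbabilityMeasure ν]
    (hν : ∀ᵐ x : ℝ ∂ν, ∃ n : ℤ, x = n) (i : ℤ) :
    (ν.real {(i : ℝ)} : ℂ) = (2 * Real.pi : ℂ)⁻¹ *
      ∫ t in (0 : ℝ)..2 * Real.pi, charFun ν t * Complex.exp (-(i * Complex.I * t)) := by
  have hint : Integrable (Function.uncurry fun t x : ℝ =>
      Complex.exp (t * x * Complex.I) * Complex.exp (-(i * Complex.I * t)))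
      ((volume.restrict (Set.uIoc 0 (2 * Real.pi))).prod ν) := by
    rw [Set.uIoc_of_le (by positivity)]
    refine Integrable.of_bound (C := 1) (by fun_prop) (Eventually.of_forall fun p => ?_)
    rw [Function.uncurry, ← Complex.exp_add, Complex.norm_exp]
    simp
  have hinner : ∀ᵐ x : ℝ ∂ν, (∫ t in (0 : ℝ)..2 * Real.pi,
      Complex.exp (t * x * Complex.I) * Complex.exp (-(i * Complex.I * t))) =
      Set.indicator {(i : ℝ)} (fun _ => (2 * Real.pi : ℂ)) x := by
    filter_upwards [hν] with x ⟨n, hn⟩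
    have h := integral_exp_int_mul_I (n - i)
    rw [hn]
    calc _ = ∫ t in (0 : ℝ)..2 * Real.pi, Complex.exp ((n - i : ℤ) * Complex.I * t) := by
          congr with t
          rw [← Complex.exp_add]
          congr 1
          push_cast
          ring
      _ = _ := by
          rw [h]
          by_cases hni : n = i
          · simp [hni]
          · simp [hni, sub_eq_zero]
  simp_rw [charFun_apply_real, ← integral_mul_const]
  rw [intervalIntegral_integral_swap hint, integral_congr_ae hinner,
    integral_indicator_const _ (measurableSet_singleton _)]
  have : (Real.pi : ℂ) ≠ 0 := by exact_mod_cast Real.pi_pos.ne'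
  rw [Complex.real_smul]
  field_simp

/-! ### Sums of independent Bernoulli variables -/

theorem normSq_bernoulli_charFun (p t : ℝ) :
    ‖(p : ℂ) * Complex.exp (t * Complex.I) + (1 - p)‖ ^ 2 =
      1 - 2 * p * (1 - p) * (1 - Real.cos t) := by
  rw [← Complex.normSq_eq_norm_sq, Complex.normSq_apply]
  simp only [Complex.add_re, Complex.add_im, Complex.mul_re, Complex.mul_im, Complex.sub_re,
    Complex.sub_im, Complex.ofReal_re, Complex.ofReal_im, Complex.one_re, Complex.one_im,
    Complex.exp_ofReal_mul_I_re, Complex.exp_ofReal_mul_I_im]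
  linear_combination p ^ 2 * Real.sin_sq_add_cos_sq t

theorem norm_bernoulli_charFun_le (p t : ℝ) :
    ‖(p : ℂ) * Complex.exp (t * Complex.I) + (1 - p)‖ ≤
      Real.exp (-(p * (1 - p) * (1 - Real.cos t))) := by
  refine le_of_sq_le_sq ?_ (Real.exp_pos _).le
  rw [normSq_bernoulli_charFun, ← Real.exp_nat_mul]
  have := Real.add_one_le_exp (-(2 * p * (1 - p) * (1 - Real.cos t)))
  refine (le_trans (by linarith) this).trans (Real.exp_le_exp.2 (by push_cast; linarith))

theorem charFun_bernoulliMeasure (p : I) (t : ℝ) :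
    charFun (bernoulliMeasure (1 : ℝ) 0 p) t =
      (p : ℂ) * Complex.exp (t * Complex.I) + (1 - (p : ℝ)) := by
  rw [charFun_apply_real, integral_bernoulliMeasure]
  simp

theorem memLp_bernoulliMeasure (p : I) : MemLp id 2 (bernoulliMeasure (1 : ℝ) 0 p) := by
  rw [memLp_two_iff_integrable_sq (by fun_prop)]
  exact integrable_bernoulliMeasure _ _ _ _

theorem variance_bernoulliMeasure (p : I) :
    Var[id; bernoulliMeasure (1 : ℝ) 0 p] = p * (1 - p) := by
  rw [variance_eq_sub (memLp_bernoulliMeasure p), integral_bernoulliMeasure,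
    integral_bernoulliMeasure]
  simp
  ring

theorem measurableSet_exists_eq_intCast : MeasurableSet {x : ℝ | ∃ m : ℤ, x = m} := by
  convert (Set.countable_range (fun m : ℤ => (m : ℝ))).measurableSet using 1
  ext x
  simp [eq_comm]

section BernoulliSum

variable {n : ℕ} {p : Fin n → I} {Ω : Type*} {mΩ : MeasurableSpace Ω} {μ : Measure Ω}
  {X : Fin n → Ω → ℝ}

theorem ae_exists_int_eq_sum (hX : ∀ j, HasLaw (X j) (bernoulliMeasure (1 : ℝ) 0 (p j)) μ) :
    ∀ᵐ x : ℝ ∂(μ.map fun ω => ∑ j, X j ω), ∃ m : ℤ, x = m := by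
  have hmeas := measurableSet_exists_eq_intCast
  have hae : AEMeasurable (fun ω => ∑ j, X j ω) μ :=
    Finset.aemeasurable_fun_sum _ fun j _ => (hX j).aemeasurable
  rw [ae_map_iff hae hmeas]
  have h1 : ∀ j, ∀ᵐ ω ∂μ, ∃ m : ℤ, X j ω = m := fun j => by
    rw [(hX j).ae_iff (p := fun x : ℝ => ∃ m : ℤ, x = m) (measurableSet_setOfPred.1 hmeas),
      bernoulliMeasure_def, ae_add_measure_iff]
    constructor
    · refine Measure.ae_smul_measure ?_ _
      rw [ae_dirac_iff hmeas]
      exact ⟨1, by simp⟩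
    · refine Measure.ae_smul_measure ?_ _
      rw [ae_dirac_iff hmeas]
      exact ⟨0, by simp⟩
  filter_upwards [ae_all_iff.2 h1] with ω hω
  choose m hm using hω
  exact ⟨∑ j, m j, by simp [hm]⟩

theorem charFun_map_sum_bernoulli
    (hX : ∀ j, HasLaw (X j) (bernoulliMeasure (1 : ℝ) 0 (p j)) μ) (hind : iIndepFun X μ) (t : ℝ) :
    charFun (μ.map fun ω => ∑ j, X j ω) t =
      ∏ j, ((p j : ℂ) * Complex.exp (t * Complex.I) + (1 - (p j : ℝ))) := by
  rw [hind.charFun_map_fun_sum_eq_prod fun j => (hX j).aemeasurable, Finset.prod_apply]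
  exact Finset.prod_congr rfl fun j _ => by rw [(hX j).map_eq, charFun_bernoulliMeasure]

theorem variance_sum_bernoulli
    (hX : ∀ j, HasLaw (X j) (bernoulliMeasure (1 : ℝ) 0 (p j)) μ) (hind : iIndepFun X μ) :
    Var[fun ω => ∑ j, X j ω; μ] = ∑ j, (p j : ℝ) * (1 - p j) := by
  have hmem : ∀ j, MemLp (X j) 2 μ := fun j => by
    have := memLp_bernoulliMeasure (p j)
    rw [← (hX j).map_eq, memLp_map_measure_iff (by fun_prop) (hX j).aemeasurable] at this
    exact this
  have := IndepFun.variance_sum (s := Finset.univ) (fun j _ => hmem j)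
    (fun i _ j _ hij => hind.indepFun hij)
  rw [show (fun ω => ∑ j, X j ω) = ∑ j, X j by ext ω; simp, this]
  exact Finset.sum_congr rfl fun j _ => by rw [(hX j).variance_eq, variance_bernoulliMeasure]

/-- The mass function of a sum of independent Bernoulli variables of variance `s` is at most
`(2π)⁻¹ ∫ e^{-s (1 - cos t)} dt`, which gives the bound `boundFun (s / 2)`. -/
theorem sqrt_mul_measureReal_sum_eq_le [IsProbabilityMeasure μ]
    (hX : ∀ j, HasLaw (X j) (bernoulliMeasure (1 : ℝ) 0 (p j)) μ) (hind : iIndepFun X μ) (i : ℤ) :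
    √(∑ j, (p j : ℝ) * (1 - p j)) * μ.real {ω | ∑ j, X j ω = (i : ℝ)} ≤
      boundFun ((∑ j, (p j : ℝ) * (1 - p j)) / 2) := by
  set s := ∑ j, (p j : ℝ) * (1 - p j) with hs
  have hae : AEMeasurable (fun ω => ∑ j, X j ω) μ :=
    Finset.aemeasurable_fun_sum _ fun j _ => (hX j).aemeasurable
  have : IsProbabilityMeasure (μ.map fun ω => ∑ j, X j ω) := Measure.isProbabilityMeasure_map hae
  have hinv := measureReal_singleton_eq_integral_charFun _ (ae_exists_int_eq_sum hX) i
  rw [map_measureReal_apply_of_aemeasurable hae (measurableSet_singleton _)] at hinv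
  change (μ.real {ω | ∑ j, X j ω = (i : ℝ)} : ℂ) = _ at hinv
  rw [boundFun_eq_integral, mul_div_cancel₀ s two_ne_zero]
  refine mul_le_mul_of_nonneg_left ?_ (Real.sqrt_nonneg _)
  have h2pi : (0 : ℝ) ≤ 2 * Real.pi := by positivity
  calc μ.real {ω | ∑ j, X j ω = (i : ℝ)} = ‖(μ.real {ω | ∑ j, X j ω = (i : ℝ)} : ℂ)‖ := by
        rw [Complex.norm_real, Real.norm_of_nonneg measureReal_nonneg]
    _ = (2 * Real.pi)⁻¹ * ‖∫ t in (0 : ℝ)..2 * Real.pi, charFun (μ.map fun ω => ∑ j, X j ω) t *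
          Complex.exp (-(i * Complex.I * t))‖ := by
        rw [hinv, norm_mul, norm_inv, show (2 * Real.pi : ℂ) = ((2 * Real.pi : ℝ) : ℂ) by simp,
          Complex.norm_real, Real.norm_of_nonneg h2pi]
    _ ≤ _ := by
        gcongr
        refine intervalIntegral.norm_integral_le_of_norm_le h2pi
          (Eventually.of_forall fun t _ => ?_) (Continuous.intervalIntegrable (by fun_prop) _ _)
        have h1 : ‖Complex.exp (-(i * Complex.I * t))‖ = 1 := by
          rw [Complex.norm_exp]
          simp
        rw [norm_mul, h1, mul_one, charFun_map_sum_bernoulli hX hind, norm_prod]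
        calc _ ≤ ∏ j, Real.exp (-((p j : ℝ) * (1 - p j) * (1 - Real.cos t))) :=
              Finset.prod_le_prod (fun _ _ => norm_nonneg _)
                fun j _ => by simpa using norm_bernoulli_charFun_le (p j) t
          _ = _ := by
              rw [← Real.exp_sum, Finset.sum_neg_distrib, ← Finset.sum_mul]

end BernoulliSum

/-! ### Two binomial variables and sharpness -/

/-- The characteristic function at parameter `1 - l` is `e^{it}` times the conjugate of the one at
parameter `l`, so their product is `e^{it}` times a real number. -/
theorem bernoulli_charFun_mul_symm (l t : ℝ) :
    ((l : ℂ) * Complex.exp (t * Complex.I) + (1 - l)) *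
      (((1 - l : ℝ) : ℂ) * Complex.exp (t * Complex.I) + (1 - (1 - l : ℝ))) =
      ((1 - 2 * l * (1 - l) * (1 - Real.cos t) : ℝ) : ℂ) * Complex.exp (t * Complex.I) := by
  have h1 : Complex.exp (t * Complex.I) * Complex.exp (-(t * Complex.I)) = 1 := by
    rw [← Complex.exp_add]; simp
  have h2 : (2 : ℂ) * Complex.cos t =
      Complex.exp (t * Complex.I) + Complex.exp (-(t * Complex.I)) := by
    rw [Complex.two_cos, neg_mul]
  push_cast
  linear_combination (-(l : ℂ) * (1 - l) * Complex.exp (t * Complex.I)) * h2 -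
    (l : ℂ) * (1 - l) * h1

theorem measureReal_singleton_eq_integral_of_charFun_eq {ν : Measure ℝ} [IsProbabilityMeasure ν]
    (hν : ∀ᵐ x : ℝ ∂ν, ∃ n : ℤ, x = n) {a : ℕ} {l : ℝ}
    (hc : ∀ t, charFun ν t = ((l : ℂ) * Complex.exp (t * Complex.I) + (1 - l)) ^ a *
      (((1 - l : ℝ) : ℂ) * Complex.exp (t * Complex.I) + (1 - (1 - l : ℝ))) ^ a) :
    ν.real {(a : ℝ)} = (2 * Real.pi)⁻¹ *
      ∫ t in (0 : ℝ)..2 * Real.pi, (1 - 2 * l * (1 - l) * (1 - Real.cos t)) ^ a := by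
  have h := measureReal_singleton_eq_integral_charFun ν hν a
  have heq : ∀ t : ℝ, charFun ν t * Complex.exp (-((a : ℤ) * Complex.I * t)) =
      (((1 - 2 * l * (1 - l) * (1 - Real.cos t)) ^ a : ℝ) : ℂ) := fun t => by
    rw [hc, ← mul_pow, bernoulli_charFun_mul_symm, mul_pow, ← Complex.exp_nat_mul, mul_assoc,
      ← Complex.exp_add]
    have : (a : ℂ) * (t * Complex.I) + -((a : ℤ) * Complex.I * t) = 0 := by push_cast; ring
    rw [this, Complex.exp_zero, mul_one, Complex.ofReal_pow]
  simp_rw [heq] at h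
  rw [intervalIntegral.integral_ofReal] at h
  exact_mod_cast h

/-- The Poisson limit: with `l = u / a`, the sum of independent `B(a, l)` and `B(a, 1 - l)`
centred at `a` approaches the difference of two Poisson variables of parameter `u`. -/
theorem tendsto_sqrt_mul_integral_pow {u : ℝ} {l : ℕ → I}
    (hl : ∀ᶠ a : ℕ in atTop, (l a : ℝ) = u / a) :
    Tendsto (fun a : ℕ => √(2 * a * (l a : ℝ) * (1 - l a)) * ((2 * Real.pi)⁻¹ *
      ∫ t in (0 : ℝ)..2 * Real.pi, (1 - 2 * (l a : ℝ) * (1 - l a) * (1 - Real.cos t)) ^ a))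
      atTop (𝓝 (boundFun u)) := by
  have hal : Tendsto (fun a : ℕ => (a : ℝ) * (l a : ℝ)) atTop (𝓝 u) := by
    refine tendsto_const_nhds.congr' ?_
    filter_upwards [hl, eventually_gt_atTop 0] with a ha h0
    have : (a : ℝ) ≠ 0 := by exact_mod_cast h0.ne'
    rw [ha]
    field_simp
  have hl0 : Tendsto (fun a : ℕ => (l a : ℝ)) atTop (𝓝 0) :=
    (tendsto_const_div_atTop_nhds_zero_nat u).congr' (hl.mono fun a ha => ha.symm)
  have hv : Tendsto (fun a : ℕ => (a : ℝ) * (l a : ℝ) * (1 - l a)) atTop (𝓝 u) := by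
    simpa using hal.mul (tendsto_const_nhds.sub hl0 : Tendsto (fun a => 1 - (l a : ℝ)) _ (𝓝 (1 - 0)))
  rw [boundFun_eq_integral]
  refine Tendsto.mul ?_ (Tendsto.const_mul _ ?_)
  · have := (hv.const_mul 2).sqrt
    simpa only [mul_assoc] using this
  · refine intervalIntegral.tendsto_integral_filter_of_dominated_convergence (fun _ => 1)
      (Eventually.of_forall fun a => (by fun_prop : Continuous _).aestronglyMeasurable)
      (Eventually.of_forall fun a => Eventually.of_forall fun t _ => ?_)
      intervalIntegrable_const (Eventually.of_forall fun t _ => ?_)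
    · have hnn : 0 ≤ 1 - 2 * (l a : ℝ) * (1 - l a) * (1 - Real.cos t) := by
        rw [← normSq_bernoulli_charFun]; positivity
      have hle : 1 - 2 * (l a : ℝ) * (1 - l a) * (1 - Real.cos t) ≤ 1 := by
        have h1 := (l a).2.1
        have h2 := sub_nonneg.2 (l a).2.2
        have h3 := sub_nonneg.2 (Real.cos_le_one t)
        have : 0 ≤ 2 * (l a : ℝ) * (1 - l a) * (1 - Real.cos t) := by positivity
        linarith
      rw [Real.norm_of_nonneg (pow_nonneg hnn a)]
      exact pow_le_one₀ hnn hle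
    · have := Real.tendsto_one_add_pow_exp_of_tendsto
        (g := fun a : ℕ => -(2 * (l a : ℝ) * (1 - l a) * (1 - Real.cos t)))
        (t := -(2 * u * (1 - Real.cos t))) ?_
      · simpa only [← sub_eq_add_neg] using this
      · refine (((hv.const_mul 2).mul_const (1 - Real.cos t)).neg).congr fun a => ?_
        ring

theorem charFun_map_cast_binomial (a : ℕ) (l : I) (t : ℝ) :
    charFun ((binomial a l).map (Nat.cast : ℕ → ℝ)) t =
      ((l : ℂ) * Complex.exp (t * Complex.I) + (1 - (l : ℝ))) ^ a := by
  rw [charFun_apply_real, integral_map_cast_binomial, add_pow, Nat.range_succ_eq_Iic]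
  refine Finset.sum_congr rfl fun k _ => ?_
  rw [mul_pow, ← Complex.exp_nat_mul, Complex.real_smul]
  push_cast
  rw [show (t : ℂ) * k * Complex.I = k * (t * Complex.I) by ring]
  ring

theorem binomial_conv_symm_real_singleton (a : ℕ) (l : I) :
    ((binomial a l).conv (binomial a (unitInterval.symm l))).real {a} = (2 * Real.pi)⁻¹ *
      ∫ t in (0 : ℝ)..2 * Real.pi, (1 - 2 * (l : ℝ) * (1 - l) * (1 - Real.cos t)) ^ a := by
  set ν := (binomial a l).conv (binomial a (unitInterval.symm l)) with hν
  have hmeas : Measurable (Nat.cast : ℕ → ℝ) := .of_discrete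
  have : IsProbabilityMeasure (ν.map (Nat.cast : ℕ → ℝ)) :=
    Measure.isProbabilityMeasure_map hmeas.aemeasurable
  rw [← measureReal_singleton_eq_integral_of_charFun_eq (ν := ν.map (Nat.cast : ℕ → ℝ))]
  · rw [map_measureReal_apply hmeas (measurableSet_singleton _)]
    congr 1
    ext k
    simp
  · exact (ae_map_iff hmeas.aemeasurable measurableSet_exists_eq_intCast).2
      (Eventually.of_forall fun k => (⟨k, by simp⟩ : ∃ m : ℤ, (k : ℝ) = m))
  · intro t
    rw [hν, ← Nat.coe_castAddMonoidHom, Measure.map_conv_addMonoidHom _ (by fun_prop),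
      Nat.coe_castAddMonoidHom, charFun_conv, charFun_map_cast_binomial, charFun_map_cast_binomial]
    simp [unitInterval.coe_symm_eq]

/-- The law of `U + V` is realised by `2a` coordinate variables on a product space, which turns a
uniform bound for Bernoulli sums into a bound for the Fourier integral. -/
theorem sqrt_mul_integral_pow_le_of_forall_le {C : ℝ}
    (hC : ∀ (n : ℕ) (p : Fin n → I) (Ω : Type) (_ : MeasurableSpace Ω) (μ : Measure Ω)
      (_ : IsProbabilityMeasure μ) (X : Fin n → Ω → ℝ),
      (∀ j, HasLaw (X j) (bernoulliMeasure (1 : ℝ) 0 (p j)) μ) → iIndepFun X μ →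
      ∀ i : ℤ, √(∑ j, (p j : ℝ) * (1 - p j)) * μ.real {ω | ∑ j, X j ω = (i : ℝ)} ≤ C)
    (a : ℕ) (l : I) :
    √(2 * a * (l : ℝ) * (1 - l)) * ((2 * Real.pi)⁻¹ *
      ∫ t in (0 : ℝ)..2 * Real.pi, (1 - 2 * (l : ℝ) * (1 - l) * (1 - Real.cos t)) ^ a) ≤ C := by
  let p : Fin (a + a) → I := Fin.append (fun _ => l) (fun _ => unitInterval.symm l)
  let μ : Measure (Fin (a + a) → ℝ) := Measure.pi fun j => bernoulliMeasure (1 : ℝ) 0 (p j)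
  let X : Fin (a + a) → (Fin (a + a) → ℝ) → ℝ := fun j ω => ω j
  have hX : ∀ j, HasLaw (X j) (bernoulliMeasure (1 : ℝ) 0 (p j)) μ :=
    fun j => (measurePreserving_eval (fun j => bernoulliMeasure (1 : ℝ) 0 (p j)) j).hasLaw
  have hind : iIndepFun X μ :=
    iIndepFun_pi (X := fun _ => id) (fun _ => aemeasurable_id)
  have h := hC (a + a) p _ _ μ inferInstance X hX hind a
  have hae : AEMeasurable (fun ω => ∑ j, X j ω) μ :=
    Finset.aemeasurable_fun_sum _ fun j _ => (hX j).aemeasurable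
  have : IsProbabilityMeasure (μ.map fun ω => ∑ j, X j ω) := Measure.isProbabilityMeasure_map hae
  have hs : ∑ j, (p j : ℝ) * (1 - p j) = 2 * a * (l : ℝ) * (1 - l) := by
    rw [Fin.sum_univ_add]
    simp only [p, Fin.append_left, Fin.append_right]
    simp [unitInterval.coe_symm_eq]
    ring
  rw [hs] at h
  rw [← measureReal_singleton_eq_integral_of_charFun_eq (ν := μ.map fun ω => ∑ j, X j ω)
    (ae_exists_int_eq_sum hX), map_measureReal_apply_of_aemeasurable hae (measurableSet_singleton _)]
  · exact_mod_cast h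
  · intro t
    rw [charFun_map_sum_bernoulli hX hind, Fin.prod_univ_add]
    simp only [p, Fin.append_left, Fin.append_right]
    simp [unitInterval.coe_symm_eq]


theorem theorem1 :
    -- the supremum defining `M` is a maximum, and its approximate value
    IsGreatest (boundFun '' Set.Ici 0) boundConst ∧
    |boundConst - 0.46882235549939533| < 3 * (10 : ℝ)⁻¹ ^ 14 ∧
    -- the uniform bound
    (∀ (n : ℕ) (p : Fin n → I) (Ω : Type*) (_ : MeasurableSpace Ω) (μ : Measure Ω)
        (_ : IsProbabilityMeasure μ) (X : Fin n → Ω → ℝ),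
        (∀ j, HasLaw (X j) (bernoulliMeasure (1 : ℝ) 0 (p j)) μ) → iIndepFun X μ →
        √(Var[fun ω => ∑ j, X j ω; μ]) = √(∑ j, (p j : ℝ) * (1 - p j)) ∧
        ∀ i : ℤ, √(∑ j, (p j : ℝ) * (1 - p j)) * μ.real {ω | ∑ j, X j ω = (i : ℝ)}
          ≤ boundConst) ∧
    -- the bound is sharp: no smaller constant works
    (∀ C : ℝ,
        (∀ (n : ℕ) (p : Fin n → I) (Ω : Type) (_ : MeasurableSpace Ω) (μ : Measure Ω)
          (_ : IsProbabilityMeasure μ) (X : Fin n → Ω → ℝ),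
          (∀ j, HasLaw (X j) (bernoulliMeasure (1 : ℝ) 0 (p j)) μ) → iIndepFun X μ →
          ∀ i : ℤ, √(∑ j, (p j : ℝ) * (1 - p j)) * μ.real {ω | ∑ j, X j ω = (i : ℝ)} ≤ C) →
        boundConst ≤ C) ∧
    -- `M` is the limit along sums of two independent binomials `B(a, λ)` and `B(a, 1 - λ)`,
    -- with `λ = u / a` and `u` any maximizer
    (∀ u : ℝ, 0 ≤ u → boundFun u = boundConst →
      ∀ lam : ℕ → I, (∀ᶠ a : ℕ in atTop, (lam a : ℝ) = u / a) →
        Tendsto (fun a : ℕ => √(2 * a * (lam a : ℝ) * (1 - lam a)) *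
            ((binomial a (lam a)).conv (binomial a (unitInterval.symm (lam a)))).real {a})
          atTop (𝓝 boundConst)) := by
  obtain ⟨x, hx, hxM, hgreat, happrox⟩ := exists_boundFun_eq_boundConst
  refine ⟨hgreat, happrox, fun n p Ω _ μ _ X hX hind => ⟨?_, fun i => ?_⟩, fun C hC => ?_,
    fun u _ huM lam hlam => ?_⟩
  · rw [variance_sum_bernoulli hX hind]
  · refine (sqrt_mul_measureReal_sum_eq_le hX hind i).trans (hgreat.2 ⟨_, ?_, rfl⟩)
    have : 0 ≤ ∑ j, (p j : ℝ) * (1 - p j) :=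
      Finset.sum_nonneg fun j _ => mul_nonneg (p j).2.1 (sub_nonneg.2 (p j).2.2)
    exact Set.mem_Ici.2 (by positivity)
  · let l : ℕ → I := fun a => Set.projIcc 0 1 zero_le_one (x / a)
    have hl : ∀ᶠ a : ℕ in atTop, (l a : ℝ) = x / a := by
      filter_upwards [(tendsto_const_div_atTop_nhds_zero_nat x).eventually_le_const one_pos]
        with a ha
      exact congrArg Subtype.val (Set.projIcc_of_mem zero_le_one ⟨by positivity, ha⟩)
    rw [← hxM]
    exact le_of_tendsto (tendsto_sqrt_mul_integral_pow hl)
      (Eventually.of_forall fun a => sqrt_mul_integral_pow_le_of_forall_le hC a (l a))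
  · rw [← huM]
    simp_rw [binomial_conv_symm_real_singleton]
    exact tendsto_sqrt_mul_integral_pow hlam
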